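/- Let $M$ be a matrix with $t$ columns and $u$ rows ($t,u\ge 1$), all of whose entries lie in $\{0,1,-1\}$. Index its entries from the lower left corner, column first, so that $M_{i,j}$ is the entry in the $i$-th column from the left and the $j$-th row from the bottom. An $M$-gridding of a permutation $\sigma$ of $\{1,\dots,k\}$ is a pair of sequences $$\tfrac12=c_0\le c_1\le\dots\le c_t=k+\tfrac12,\qquad \tfrac12=r_0\le r_1\le\dots\le r_u=k+\tfrac12$$ with all $c_i-\tfrac12$ and $r_j-\tfrac12$ in $\{0,\dots,k\}$, such that for all $1\le i\le t$ and $1\le j\le u$ the subsequence of $\sigma$ consisting of the terms with index between $c_{i-1}$ and $c_i$ and value between $r_{j-1}$ and $r_j$ is increasing if $M_{i,j}=1$, decreasing if $M_{i,j}=-1$, and empty if $M_{i,j}=0$. The monotone grid class $\mathrm{Grid}(M)$ is the set of all permutations that have an $M$-gridding; let $\mathrm{Grid}_k(M)$ be the set of those of length $k$. The row-column graph $G(M)$ is the bipartite graph whose vertices are the rows and the columns of $M$, with row $j$ adjacent to column $i$ if and only if $M_{i,j}\ne 0$. The spectral radius $\rho(G)$ of a finite graph $G$ is the largest eigenvalue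 of its adjacency matrix. Theorem. For every such matrix $M$, the growth rate $\lim_{k\to\infty}|\mathrm{Grid}_k(M)|^{1/k}$ of $\mathrm{Grid}(M)$ exists and $$\lim_{k\to\infty}|\mathrm{Grid}_k(M)|^{1/k}=\rho(G(M))^2 .$$ -/

import Mathlib

open Filter Topology

/-- An `M`-gridding of a permutation `σ` of length `k`, for a matrix `M` with `t` columns and
`u` rows.  As usual for grid classes, matrices are indexed from the lower left corner, column
first: `M i j` is the entry in the `i`-th column from the left and the `j`-th row from the bottom.

A divider at the half-integer `d + 1/2` is recorded as the natural number `d`.  Positions and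
values of `σ` are numbered from `0`, so position `x` (the `(x+1)`-st) lies between the dividers
`c i + 1/2` and `c (i+1) + 1/2` if and only if `c i ≤ x < c (i+1)`; likewise for values. -/
structure IsGridding {t u : ℕ} (M : Matrix (Fin t) (Fin u) ℤ) {k : ℕ} (σ : Equiv.Perm (Fin k))
    (c : Fin (t + 1) → ℕ) (r : Fin (u + 1) → ℕ) : Prop where
  col_mono : Monotone c
  col_first : c 0 = 0
  col_last : c (Fin.last t) = k
  row_mono : Monotone r
  row_first : r 0 = 0
  row_last : r (Fin.last u) = k
  increasing : ∀ i j, M i j = 1 →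
    StrictMonoOn σ {x : Fin k | (c i.castSucc ≤ (x : ℕ) ∧ (x : ℕ) < c i.succ) ∧
      (r j.castSucc ≤ (σ x : ℕ) ∧ (σ x : ℕ) < r j.succ)}
  decreasing : ∀ i j, M i j = -1 →
    StrictAntiOn σ {x : Fin k | (c i.castSucc ≤ (x : ℕ) ∧ (x : ℕ) < c i.succ) ∧
      (r j.castSucc ≤ (σ x : ℕ) ∧ (σ x : ℕ) < r j.succ)}
  empty : ∀ i j, M i j = 0 →
    {x : Fin k | (c i.castSucc ≤ (x : ℕ) ∧ (x : ℕ) < c i.succ) ∧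
      (r j.castSucc ≤ (σ x : ℕ) ∧ (σ x : ℕ) < r j.succ)} = ∅

/-- The monotone grid class `Grid(M)`, given by length: `gridClass M k` is the set of the
permutations of length `k` that have an `M`-gridding. -/
def gridClass {t u : ℕ} (M : Matrix (Fin t) (Fin u) ℤ) (k : ℕ) : Set (Equiv.Perm (Fin k)) :=
  {σ | ∃ c r, IsGridding M σ c r}

/-- The growth rate of a collection of permutations, with `C k` the set of its members of
length `k`, exists and is equal to `g`: the sequence `|C k| ^ (1/k)` converges to `g`. -/
def HasGrowthRate (C : (k : ℕ) → Set (Equiv.Perm (Fin k))) (g : ℝ) : Prop :=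
  Tendsto (fun k : ℕ => ((C k).ncard : ℝ) ^ (1 / (k : ℝ))) atTop (𝓝 g)

/-- The row-column graph `G(M)`: the vertices are the rows `Sum.inl j` and the columns
`Sum.inr i` of `M`, and row `j` is joined to column `i` when the entry there is nonzero. -/
def rowColumnGraph {t u : ℕ} (M : Matrix (Fin t) (Fin u) ℤ) : SimpleGraph (Fin u ⊕ Fin t) where
  Adj
    | Sum.inl j, Sum.inr i => M i j ≠ 0
    | Sum.inr i, Sum.inl j => M i j ≠ 0
    | _, _ => False
  symm := ⟨by rintro (_ | _) (_ | _) h <;> exact h⟩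
  loopless := ⟨by rintro (_ | _) h <;> exact h⟩

open Classical in
/-- The (real) eigenvalues of the adjacency matrix of a finite graph. -/
def graphEigenvalues {V : Type*} [Fintype V] (G : SimpleGraph V) : Set ℝ :=
  {μ | Module.End.HasEigenvalue (Matrix.toLin' (G.adjMatrix ℝ)) μ}

/-- The spectral radius of a finite graph: the largest eigenvalue of its adjacency matrix.
It is attained as soon as there is a vertex, see `graphSpectralRadius_isGreatest`. -/
noncomputable def graphSpectralRadius {V : Type*} [Fintype V] (G : SimpleGraph V) : ℝ :=
  sSup (graphEigenvalues G)

theorem graphSpectralRadius_isGreatest {V : Type*} [Fintype V] [Nonempty V]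
    (G : SimpleGraph V) : IsGreatest (graphEigenvalues G) (graphSpectralRadius G) := by
  classical
  have hfin : (graphEigenvalues G).Finite := Module.End.finite_hasEigenvalue _
  have hne : (graphEigenvalues G).Nonempty := by
    have hA : (G.adjMatrix ℝ).IsHermitian := by
      rw [Matrix.IsHermitian, Matrix.conjTranspose_eq_transpose_of_trivial]
      exact G.isSymm_adjMatrix
    obtain ⟨v⟩ := ‹Nonempty V›
    refine ⟨hA.eigenvalues v, ?_⟩
    have h := hA.eigenvalues_mem_spectrum_real v
    rw [← Matrix.spectrum_toLin', ← Module.End.hasEigenvalue_iff_mem_spectrum] at h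
    unfold graphEigenvalues
    convert h
  exact ⟨hne.csSup_mem hfin, fun _ hx => le_csSup hfin.bddAbove hx⟩

/-! Fix the dividers. A gridded permutation is then encoded without loss by two words: the row of
each term, read by position, and the column of each term, read by value
(`IsCellwise.eq_of_comp_eq`). Two words come from a gridded permutation as soon as they put equally
many points in every cell and none in a zero cell (`exists_isCellwise`). So counting gridded
permutations is counting pairs of words, and there are only polynomially many choices of dividers.

Upper bound: give the letters weights `p i j` and `q i j`, with total at most 1 in each column and
each row respectively, and with `p i j * q i j = s` on nonzero cells. Every pair of words has weight
`s ^ k`, so there are at most `s⁻¹ ^ k` of them. A positive vector (x on columns, y on rows) that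
adjacency expands by at most l gives `p = y/(l x)`, `q = x/(l y)` and `s = l⁻²`. Such vectors exist
for l arbitrarily close to ρ, or below; the slack avoids any connectedness assumption, since a
nonnegative eigenvector for ρ may vanish somewhere.

Lower bound: with `a i j` points in the cells, the pairs of words number a product of multinomial
coefficients, and for fixed dividers they give distinct permutations. Take cell proportions `x i * y
j / Z` from a nonnegative eigenvector for ρ; its zeros are harmless. Stirling's formula turns the
multinomials into entropies, whose sum is exactly `log (ρ ^ 2)`. -/

/-! ### Extremal eigenvectors of symmetric nonnegative matrices. -/

theorem Matrix.IsHermitian.posSemidef_smul_one_sub {n : Type*} [Fintype n] [DecidableEq n]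
    {A : Matrix n n ℝ} (hA : A.IsHermitian) {μ : ℝ}
    (hμ : μ ∈ upperBounds {ν | Module.End.HasEigenvalue (Matrix.toLin' A) ν}) :
    (μ • (1 : Matrix n n ℝ) - A).PosSemidef := by
  have hB : (μ • (1 : Matrix n n ℝ) - A).IsHermitian := by
    rw [Matrix.IsHermitian, Matrix.conjTranspose_sub, hA.eq]
    simp
  rw [hB.posSemidef_iff_eigenvalues_nonneg]
  intro i
  have h1 := hB.mulVec_eigenvectorBasis i
  have h0 : (hB.eigenvectorBasis i).ofLp ≠ 0 := by
    intro h
    exact hB.eigenvectorBasis.orthonormal.ne_zero i (by ext j; simpa using congrFun h j)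
  have h2 : Module.End.HasEigenvalue (Matrix.toLin' A) (μ - hB.eigenvalues i) := by
    refine Module.End.hasEigenvalue_of_hasEigenvector (x := (hB.eigenvectorBasis i).ofLp) ⟨?_, h0⟩
    rw [Module.End.mem_eigenspace_iff, Matrix.toLin'_apply, sub_smul, ← h1, Matrix.sub_mulVec,
      Matrix.smul_mulVec, Matrix.one_mulVec]
    abel
  have := hμ h2
  simp only [Pi.zero_apply]
  linarith

theorem Matrix.IsHermitian.dotProduct_mulVec_le {n : Type*} [Fintype n] [DecidableEq n]
    {A : Matrix n n ℝ} (hA : A.IsHermitian) {μ : ℝ}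
    (hμ : μ ∈ upperBounds {ν | Module.End.HasEigenvalue (Matrix.toLin' A) ν}) (x : n → ℝ) :
    x ⬝ᵥ A.mulVec x ≤ μ * (x ⬝ᵥ x) := by
  have h := (hA.posSemidef_smul_one_sub hμ).dotProduct_mulVec_nonneg x
  simp only [star_trivial, Matrix.sub_mulVec, Matrix.smul_mulVec, Matrix.one_mulVec,
    dotProduct_sub, dotProduct_smul, smul_eq_mul] at h
  linarith

/-- The largest eigenvalue of a symmetric nonnegative matrix has a nonnegative eigenvector. -/
theorem Matrix.IsHermitian.exists_nonneg_eigenvector {n : Type*} [Fintype n] [DecidableEq n]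
    {A : Matrix n n ℝ} (hA : A.IsHermitian) (h0 : ∀ i j, 0 ≤ A i j) {μ : ℝ}
    (hμ : IsGreatest {ν | Module.End.HasEigenvalue (Matrix.toLin' A) ν} μ) :
    ∃ v : n → ℝ, v ≠ 0 ∧ (∀ i, 0 ≤ v i) ∧ A.mulVec v = μ • v := by
  obtain ⟨w, hw⟩ := hμ.1.exists_hasEigenvector
  have hAw : A.mulVec w = μ • w := by
    simpa [Matrix.toLin'_apply] using hw.apply_eq_smul
  -- Taking absolute values keeps the norm and does not lower the quadratic form, so `|w|` is a zero
  -- of the positive semidefinite form of `μ - A`, hence lies in its kernel.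
  refine ⟨fun i => |w i|, fun h => hw.2 (by ext i; simpa using congrFun h i),
    fun i => abs_nonneg _, ?_⟩
  have hP := hA.posSemidef_smul_one_sub hμ.2
  have h1 : w ⬝ᵥ A.mulVec w ≤ (fun i => |w i|) ⬝ᵥ A.mulVec (fun i => |w i|) := by
    simp only [dotProduct, Matrix.mulVec, Finset.mul_sum]
    refine Finset.sum_le_sum fun i _ => Finset.sum_le_sum fun j _ => ?_
    refine (le_abs_self _).trans_eq ?_
    rw [abs_mul, abs_mul, abs_of_nonneg (h0 i j)]
  have h2 : w ⬝ᵥ w = (fun i => |w i|) ⬝ᵥ (fun i => |w i|) := by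
    simp [dotProduct]
  have h3 := hP.dotProduct_mulVec_nonneg (fun i => |w i|)
  have h4 : star (fun i => |w i|) ⬝ᵥ
      (μ • (1 : Matrix n n ℝ) - A).mulVec (fun i => |w i|) = 0 := by
    refine le_antisymm ?_ h3
    simp only [star_trivial, Matrix.sub_mulVec, Matrix.smul_mulVec, Matrix.one_mulVec,
      dotProduct_sub, dotProduct_smul, smul_eq_mul, ← h2]
    rw [hAw, dotProduct_smul, smul_eq_mul] at h1
    linarith
  rw [hP.dotProduct_mulVec_zero_iff, Matrix.sub_mulVec, Matrix.smul_mulVec, Matrix.one_mulVec,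
    sub_eq_zero] at h4
  exact h4.symm

theorem Matrix.IsHermitian.exists_isGreatest_eigenvalue {n : Type*} [Fintype n] [DecidableEq n]
    [Nonempty n] {A : Matrix n n ℝ} (hA : A.IsHermitian) :
    ∃ μ, IsGreatest {ν | Module.End.HasEigenvalue (Matrix.toLin' A) ν} μ := by
  obtain ⟨v⟩ := ‹Nonempty n›
  have hfin : {ν | Module.End.HasEigenvalue (Matrix.toLin' A) ν}.Finite :=
    Module.End.finite_hasEigenvalue _
  have hne : {ν | Module.End.HasEigenvalue (Matrix.toLin' A) ν}.Nonempty := by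
    refine ⟨hA.eigenvalues v, ?_⟩
    have h := hA.eigenvalues_mem_spectrum_real v
    rwa [← Matrix.spectrum_toLin', ← Module.End.hasEigenvalue_iff_mem_spectrum] at h
  exact ⟨_, hne.csSup_mem hfin, fun _ hx => le_csSup hfin.bddAbove hx⟩

/-- A symmetric nonnegative matrix with largest eigenvalue `μ` has, for every `δ > 0`, a positive
vector that it expands by a factor of at most `μ + δ`. -/
theorem Matrix.IsHermitian.exists_pos_mulVec_le {n : Type*} [Fintype n] [DecidableEq n]
    [Nonempty n] {A : Matrix n n ℝ} (hA : A.IsHermitian) (h0 : ∀ i j, 0 ≤ A i j) {μ : ℝ}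
    (hμ : μ ∈ upperBounds {ν | Module.End.HasEigenvalue (Matrix.toLin' A) ν})
    {δ : ℝ} (hδ : 0 < δ) :
    ∃ (l : ℝ) (v : n → ℝ), 0 < l ∧ l ≤ μ + δ ∧ (∀ i, 0 < v i) ∧
      ∀ i, A.mulVec v i ≤ l * v i := by
  have hcard : (0 : ℝ) < Fintype.card n := by exact_mod_cast Fintype.card_pos
  -- Adding ε to every entry forces a nonnegative eigenvector to be positive. By Cauchy–Schwarz the
  -- perturbation has quadratic form at most `ε * card n = δ` times the squared norm, so the top
  -- eigenvalue rises by at most δ.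
  set ε : ℝ := δ / Fintype.card n with hε
  have hε0 : 0 < ε := by positivity
  let J : Matrix n n ℝ := Matrix.of fun _ _ => ε
  have hJ : ∀ v i, J.mulVec v i = ε * ∑ j, v j := fun v i => by
    simp [J, Matrix.mulVec, dotProduct, Finset.mul_sum]
  have hJh : J.IsHermitian := by ext i j; simp [J]
  have hAJ : (A + J).IsHermitian := hA.add hJh
  obtain ⟨l, hl⟩ := hAJ.exists_isGreatest_eigenvalue
  obtain ⟨v, hv0, hv, hlv⟩ := hAJ.exists_nonneg_eigenvector
    (fun i j => add_nonneg (h0 i j) hε0.le) hl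
  obtain ⟨i₀, hi₀⟩ := Function.ne_iff.1 hv0
  have hpos : 0 < v i₀ := lt_of_le_of_ne (hv i₀) (Ne.symm hi₀)
  have hsum : 0 < ∑ j, v j := hpos.trans_le (Finset.single_le_sum (fun i _ => hv i) (Finset.mem_univ _))
  have hAv : ∀ i, 0 ≤ A.mulVec v i := fun i =>
    Finset.sum_nonneg fun j _ => mul_nonneg (h0 i j) (hv j)
  have heq : ∀ i, A.mulVec v i + ε * ∑ j, v j = l * v i := fun i => by
    have := congrFun hlv i
    rwa [Matrix.add_mulVec, Pi.add_apply, hJ, Pi.smul_apply, smul_eq_mul] at this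
  have hlpos : ∀ i, 0 < l * v i := fun i => by
    rw [← heq]; exact add_pos_of_nonneg_of_pos (hAv i) (mul_pos hε0 hsum)
  have hl0 : 0 < l := pos_of_mul_pos_left (hlpos i₀) (hv i₀)
  refine ⟨l, v, hl0, ?_, fun i => pos_of_mul_pos_right (hlpos i) hl0.le, fun i => ?_⟩
  · have h1 := hA.dotProduct_mulVec_le hμ v
    have h2 : v ⬝ᵥ A.mulVec v + ε * (∑ j, v j) ^ 2 = l * (v ⬝ᵥ v) := by
      simp only [dotProduct, Finset.mul_sum]
      rw [sq, Finset.sum_mul, Finset.mul_sum, ← Finset.sum_add_distrib]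
      refine Finset.sum_congr rfl fun i _ => ?_
      linear_combination v i * heq i
    have h3 : (∑ j, v j) ^ 2 ≤ Fintype.card n * (v ⬝ᵥ v) := by
      have := sq_sum_le_card_mul_sum_sq (s := Finset.univ) (f := v)
      simpa [dotProduct, sq] using this
    have h4 : 0 < v ⬝ᵥ v :=
      (mul_pos hpos hpos).trans_le (Finset.single_le_sum (f := fun i => v i * v i)
        (fun i _ => mul_self_nonneg _) (Finset.mem_univ i₀))
    have h5 : ε * (∑ j, v j) ^ 2 ≤ δ * (v ⬝ᵥ v) := by
      refine (mul_le_mul_of_nonneg_left h3 hε0.le).trans_eq ?_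
      rw [hε]; field_simp
    refine le_of_mul_le_mul_right ?_ h4
    linarith
  · have := mul_pos hε0 hsum
    linarith [heq i]

/-! ### Gridded permutations and their encoding by words. -/

/-- Successive dividers partition `Fin k` into blocks. -/
theorem exists_block {n k : ℕ} {c : Fin (n + 1) → ℕ} (hc : Monotone c) (h0 : c 0 = 0)
    (hl : c (Fin.last n) = k) :
    ∃ col : Fin k → Fin n, ∀ x i, col x = i ↔ c i.castSucc ≤ (x : ℕ) ∧ (x : ℕ) < c i.succ := by
  have hex : ∀ x : Fin k, ∃ i : Fin n, c i.castSucc ≤ (x : ℕ) ∧ (x : ℕ) < c i.succ := by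
    intro x
    by_contra! h
    have : ∀ i, c i ≤ x := fun i => by
      induction i using Fin.induction with
      | zero => omega
      | succ i ih => exact h i ih
    have := this (Fin.last n)
    omega
  choose col hcol using hex
  refine ⟨col, fun x i => ⟨fun h => h ▸ hcol x, fun h => ?_⟩⟩
  have h' := hcol x
  rcases lt_trichotomy (col x) i with hlt | heq | hlt
  · have := hc (Fin.succ_le_castSucc_iff.2 hlt)
    omega
  · exact heq
  · have := hc (Fin.succ_le_castSucc_iff.2 hlt)
    omega

/-- `σ` is monotone as prescribed by `M` on the cells cut out by the column of a position and the
row of a value. -/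
structure IsCellwise {t u : ℕ} (M : Matrix (Fin t) (Fin u) ℤ) {k : ℕ} (col : Fin k → Fin t)
    (row : Fin k → Fin u) (σ : Equiv.Perm (Fin k)) : Prop where
  increasing : ∀ i j, M i j = 1 → StrictMonoOn σ {x | col x = i ∧ row (σ x) = j}
  decreasing : ∀ i j, M i j = -1 → StrictAntiOn σ {x | col x = i ∧ row (σ x) = j}
  ne_zero : ∀ x, M (col x) (row (σ x)) ≠ 0

theorem IsGridding.isCellwise {t u : ℕ} {M : Matrix (Fin t) (Fin u) ℤ} {k : ℕ}
    {σ : Equiv.Perm (Fin k)} {c : Fin (t + 1) → ℕ} {r : Fin (u + 1) → ℕ}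
    (h : IsGridding M σ c r) {col : Fin k → Fin t} {row : Fin k → Fin u}
    (hcol : ∀ x i, col x = i ↔ c i.castSucc ≤ (x : ℕ) ∧ (x : ℕ) < c i.succ)
    (hrow : ∀ y j, row y = j ↔ r j.castSucc ≤ (y : ℕ) ∧ (y : ℕ) < r j.succ) :
    IsCellwise M col row σ where
  increasing i j hij := by simpa only [hcol, hrow] using h.increasing i j hij
  decreasing i j hij := by simpa only [hcol, hrow] using h.decreasing i j hij
  ne_zero x hx := by
    have := h.empty _ _ hx
    simp only [← hcol, ← hrow, Set.eq_empty_iff_forall_notMem] at this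
    exact this x ⟨rfl, rfl⟩

theorem IsCellwise.isGridding {t u : ℕ} {M : Matrix (Fin t) (Fin u) ℤ} {k : ℕ}
    {σ : Equiv.Perm (Fin k)} {c : Fin (t + 1) → ℕ} {r : Fin (u + 1) → ℕ}
    {col : Fin k → Fin t} {row : Fin k → Fin u} (h : IsCellwise M col row σ)
    (hc : Monotone c) (hc0 : c 0 = 0) (hcl : c (Fin.last t) = k)
    (hr : Monotone r) (hr0 : r 0 = 0) (hrl : r (Fin.last u) = k)
    (hcol : ∀ x i, col x = i ↔ c i.castSucc ≤ (x : ℕ) ∧ (x : ℕ) < c i.succ)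
    (hrow : ∀ y j, row y = j ↔ r j.castSucc ≤ (y : ℕ) ∧ (y : ℕ) < r j.succ) :
    IsGridding M σ c r where
  col_mono := hc
  col_first := hc0
  col_last := hcl
  row_mono := hr
  row_first := hr0
  row_last := hrl
  increasing i j hij := by simpa only [hcol, hrow] using h.increasing i j hij
  decreasing i j hij := by simpa only [hcol, hrow] using h.decreasing i j hij
  empty i j hij := by
    simp only [← hcol, ← hrow, Set.eq_empty_iff_forall_notMem]
    rintro x ⟨rfl, rfl⟩
    exact h.ne_zero x hij

/-- A permutation that preserves a set and is strictly increasing on it fixes it pointwise. -/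
theorem Equiv.Perm.apply_eq_of_strictMonoOn {k : ℕ} (π : Equiv.Perm (Fin k)) {s : Set (Fin k)}
    (hs : ∀ x ∈ s, π x ∈ s) (hπ : StrictMonoOn π s) {x : Fin k} (hx : x ∈ s) : π x = x := by
  let f : s → s := fun x => ⟨π x, hs x x.2⟩
  have hf : StrictMono f := fun a b hab => hπ a.2 b.2 hab
  have h1 : (⟨x, hx⟩ : s) ≤ f ⟨x, hx⟩ := hf.le_apply
  have h2 : f ⟨x, hx⟩ ≤ ⟨x, hx⟩ := hf.apply_le
  exact congrArg Subtype.val (le_antisymm h2 h1)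

/-- A cellwise monotone permutation is determined by the rows of its terms and the columns of the
terms of its inverse. -/
theorem IsCellwise.eq_of_comp_eq {t u : ℕ} {M : Matrix (Fin t) (Fin u) ℤ}
    (hM : ∀ i j, M i j = 0 ∨ M i j = 1 ∨ M i j = -1) {k : ℕ}
    {col : Fin k → Fin t} {row : Fin k → Fin u} {σ τ : Equiv.Perm (Fin k)}
    (hσ : IsCellwise M col row σ) (hτ : IsCellwise M col row τ)
    (hf : ∀ x, row (σ x) = row (τ x)) (hg : ∀ y, col (σ.symm y) = col (τ.symm y)) : σ = τ := by
  -- `τ⁻¹ ∘ σ` maps the positions of each cell to themselves. It is increasing there even in a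
  -- decreasing cell, because σ and τ reverse order together.
  have key : ∀ x, (σ.trans τ.symm) x = x := by
    intro x
    have hs : ∀ z ∈ {z | col z = col x ∧ row (σ z) = row (σ x)},
        (σ.trans τ.symm) z ∈ {z | col z = col x ∧ row (σ z) = row (σ x)} := by
      rintro z ⟨h1, h2⟩
      refine ⟨?_, ?_⟩
      · rw [Equiv.trans_apply, ← hg, Equiv.symm_apply_apply, h1]
      · rw [hf, Equiv.trans_apply, Equiv.apply_symm_apply, h2]
    refine Equiv.Perm.apply_eq_of_strictMonoOn _ hs ?_ ⟨rfl, rfl⟩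
    have hτs : ∀ z, τ ((σ.trans τ.symm) z) = σ z := fun z => by simp
    rcases hM (col x) (row (σ x)) with h | h | h
    · exact absurd h (hσ.ne_zero x)
    · intro a ha b hb hab
      have h1 := hσ.increasing _ _ h ha hb hab
      have h2 := (hτ.increasing _ _ h).lt_iff_lt (a := (σ.trans τ.symm) a)
        (b := (σ.trans τ.symm) b) ⟨(hs a ha).1, (hf _).symm.trans (hs a ha).2⟩
        ⟨(hs b hb).1, (hf _).symm.trans (hs b hb).2⟩
      rw [hτs, hτs] at h2
      exact h2.1 h1
    · intro a ha b hb hab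
      have h1 := hσ.decreasing _ _ h ha hb hab
      have h2 := (hτ.decreasing _ _ h).lt_iff_gt (a := (σ.trans τ.symm) b)
        (b := (σ.trans τ.symm) a) ⟨(hs b hb).1, (hf _).symm.trans (hs b hb).2⟩
        ⟨(hs a ha).1, (hf _).symm.trans (hs a ha).2⟩
      rw [hτs, hτs] at h2
      exact h2.1 h1
  ext x
  have := congrArg τ (key x)
  simp only [Equiv.trans_apply, Equiv.apply_symm_apply] at this
  rw [this]

/-! ### Upper bound by weighted words. -/

/-- The pair of words encoding σ has weight `∏ p * ∏ q`. Reindexing the second product along σ pairs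
the factors point by point, giving `s ^ k`. The weights of all pairs of words sum to a product of
column and row totals, which is at most 1. -/
theorem ncard_isCellwise_mul_pow_le_one {t u : ℕ} {M : Matrix (Fin t) (Fin u) ℤ}
    (hM : ∀ i j, M i j = 0 ∨ M i j = 1 ∨ M i j = -1) {k : ℕ}
    (col : Fin k → Fin t) (row : Fin k → Fin u) {p q : Fin t → Fin u → ℝ} {s : ℝ}
    (hp : ∀ i j, 0 ≤ p i j) (hq : ∀ i j, 0 ≤ q i j) (hp1 : ∀ i, ∑ j, p i j ≤ 1)
    (hq1 : ∀ j, ∑ i, q i j ≤ 1) (hpq : ∀ i j, M i j ≠ 0 → p i j * q i j = s) :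
    ({σ | IsCellwise M col row σ}.ncard : ℝ) * s ^ k ≤ 1 := by
  classical
  let Φ : Equiv.Perm (Fin k) → (Fin k → Fin u) × (Fin k → Fin t) :=
    fun σ => (fun x => row (σ x), fun y => col (σ.symm y))
  let w : (Fin k → Fin u) × (Fin k → Fin t) → ℝ :=
    fun z => (∏ x, p (col x) (z.1 x)) * ∏ y, q (z.2 y) (row y)
  have hw : ∀ z, 0 ≤ w z := fun z => mul_nonneg (Finset.prod_nonneg fun _ _ => hp _ _)
    (Finset.prod_nonneg fun _ _ => hq _ _)
  have hΦ : ∀ σ, IsCellwise M col row σ → w (Φ σ) = s ^ k := fun σ hσ => by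
    have : ∏ y, q (col (σ.symm y)) (row y) = ∏ x, q (col x) (row (σ x)) := by
      rw [← Equiv.prod_comp σ]; simp
    simp only [w, Φ]
    rw [this, ← Finset.prod_mul_distrib,
      Finset.prod_congr rfl fun x _ => hpq (col x) (row (σ x)) (hσ.ne_zero x)]
    simp
  have hinj : Set.InjOn Φ (Finset.univ.filter fun σ => IsCellwise M col row σ) := by
    intro σ hσ τ hτ h
    simp only [Finset.coe_filter, Finset.mem_univ, true_and, Set.mem_ofPred_eq] at hσ hτ
    exact hσ.eq_of_comp_eq hM hτ (fun x => congrFun (congrArg Prod.fst h) x)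
      fun y => congrFun (congrArg Prod.snd h) y
  have hcard : {σ | IsCellwise M col row σ}.ncard
      = (Finset.univ.filter fun σ => IsCellwise M col row σ).card := by
    rw [← Set.ncard_coe_finset]; simp
  calc ({σ | IsCellwise M col row σ}.ncard : ℝ) * s ^ k
      = ∑ σ with IsCellwise M col row σ, w (Φ σ) := by
        rw [Finset.sum_congr rfl fun σ hσ => hΦ σ (Finset.mem_filter.1 hσ).2, hcard]
        simp
    _ = ∑ z ∈ (Finset.univ.filter fun σ => IsCellwise M col row σ).image Φ, w z :=
        (Finset.sum_image hinj).symm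
    _ ≤ ∑ z, w z := Finset.sum_le_sum_of_subset_of_nonneg (Finset.subset_univ _)
        fun z _ _ => hw z
    _ = (∏ x, ∑ j, p (col x) j) * ∏ y, ∑ i, q i (row y) := by
        rw [Finset.prod_univ_sum, Finset.prod_univ_sum, Fintype.piFinset_univ,
          Fintype.piFinset_univ, Finset.sum_mul_sum, Fintype.sum_prod_type]
    _ ≤ 1 := mul_le_one₀ (Finset.prod_le_one (fun x _ => Finset.sum_nonneg fun _ _ => hp _ _)
          fun x _ => hp1 _) (Finset.prod_nonneg fun y _ => Finset.sum_nonneg fun _ _ => hq _ _)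
          (Finset.prod_le_one (fun x _ => Finset.sum_nonneg fun _ _ => hq _ _) fun y _ => hq1 _)

/-- There are polynomially many choices of dividers, so weights that bound the number of cellwise
monotone permutations bound the whole grid class. -/
theorem ncard_gridClass_mul_pow_le {t u : ℕ} {M : Matrix (Fin t) (Fin u) ℤ}
    (hM : ∀ i j, M i j = 0 ∨ M i j = 1 ∨ M i j = -1) (k : ℕ) {p q : Fin t → Fin u → ℝ} {s : ℝ}
    (hs : 0 ≤ s)
    (hp : ∀ i j, 0 ≤ p i j) (hq : ∀ i j, 0 ≤ q i j) (hp1 : ∀ i, ∑ j, p i j ≤ 1)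
    (hq1 : ∀ j, ∑ i, q i j ≤ 1) (hpq : ∀ i j, M i j ≠ 0 → p i j * q i j = s) :
    ((gridClass M k).ncard : ℝ) * s ^ k ≤ ((k : ℝ) + 1) ^ (t + 1 + (u + 1)) := by
  classical
  -- Every divider lies between 0 and k, so k + 1 values suffice for each.
  let G : (Fin (t + 1) → Fin (k + 1)) × (Fin (u + 1) → Fin (k + 1)) →
      Set (Equiv.Perm (Fin k)) := fun d =>
    {σ | IsGridding M σ (fun i => d.1 i) (fun j => d.2 j)}
  have hG : ∀ d, ((G d).ncard : ℝ) * s ^ k ≤ 1 := fun d => by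
    rcases (G d).eq_empty_or_nonempty with h | ⟨σ₀, h⟩
    · simp [h]
    · obtain ⟨col, hcol⟩ := exists_block h.col_mono h.col_first h.col_last
      obtain ⟨row, hrow⟩ := exists_block h.row_mono h.row_first h.row_last
      refine le_trans (mul_le_mul_of_nonneg_right ?_ (pow_nonneg hs k))
        (ncard_isCellwise_mul_pow_le_one hM col row hp hq hp1 hq1 hpq)
      have hsub : G d ⊆ {σ | IsCellwise M col row σ} :=
        fun σ hσ => IsGridding.isCellwise hσ hcol hrow
      exact_mod_cast Set.ncard_le_ncard hsub (Set.toFinite _)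
  have hsub : gridClass M k ⊆ ⋃ d ∈ Finset.univ, G d := by
    rintro σ ⟨c, r, h⟩
    have hc : ∀ i, c i < k + 1 := fun i =>
      Nat.lt_succ_of_le (h.col_last ▸ h.col_mono (Fin.le_last i))
    have hr : ∀ i, r i < k + 1 := fun i =>
      Nat.lt_succ_of_le (h.row_last ▸ h.row_mono (Fin.le_last i))
    simp only [Finset.mem_univ, Set.iUnion_true, Set.mem_iUnion]
    exact ⟨(fun i => ⟨c i, hc i⟩, fun j => ⟨r j, hr j⟩), h⟩
  have h1 : ((gridClass M k).ncard : ℝ) ≤ ∑ d, ((G d).ncard : ℝ) := by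
    exact_mod_cast (Set.ncard_le_ncard hsub (Set.toFinite _)).trans
      (Finset.set_ncard_biUnion_le _ _)
  calc ((gridClass M k).ncard : ℝ) * s ^ k ≤ (∑ d, ((G d).ncard : ℝ)) * s ^ k :=
        mul_le_mul_of_nonneg_right h1 (pow_nonneg hs k)
    _ = ∑ d, ((G d).ncard : ℝ) * s ^ k := Finset.sum_mul _ _ _
    _ ≤ ∑ _d : (Fin (t + 1) → Fin (k + 1)) × (Fin (u + 1) → Fin (k + 1)), (1 : ℝ) :=
        Finset.sum_le_sum fun d _ => hG d
    _ = ((k : ℝ) + 1) ^ (t + 1 + (u + 1)) := by simp [pow_add]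

/-! ### Lower bound by multinomial coefficients. -/

/-- The permutations of `α` that preserve `col` act on the functions with prescribed numbers of
values on the fibres of `col`, with stabilizers of known size. -/
theorem prod_factorial_le_card_mul {α β γ : Type*} [Fintype α] [Fintype β] [Fintype γ]
    [DecidableEq α] [DecidableEq β] [DecidableEq γ] (col : α → β) (f₀ : α → γ) :
    ∏ i, (Fintype.card {x // col x = i}).factorial ≤
      (Finset.univ.filter fun f : α → γ => ∀ p : β × γ,
        Fintype.card {x // (col x, f x) = p} = Fintype.card {x // (col x, f₀ x) = p}).card *
      ∏ p : β × γ, (Fintype.card {x // (col x, f₀ x) = p}).factorial := by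
  rw [← DomMulAct.stabilizer_card col, ← DomMulAct.stabilizer_card fun x => (col x, f₀ x),
    Fintype.card_subtype, mul_comm]
  -- Map each π preserving `col` to `f₀ ∘ π`. Once a member π₀ of a fibre is fixed, composing with
  -- its inverse injects the fibre into the permutations preserving both `col` and `f₀`. Only this
  -- inequality is needed, not transitivity of the action.
  refine Finset.card_le_mul_card_image_of_maps_to (f := fun π : Equiv.Perm α => f₀ ∘ π) ?_ _ ?_
  · intro π hπ
    have hπ' : ∀ x, col (π x) = col x := congrFun (Finset.mem_filter.1 hπ).2
    refine Finset.mem_filter.2 ⟨Finset.mem_univ _, fun p => Fintype.card_congr ?_⟩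
    exact π.subtypeEquiv fun x => by simp [hπ']
  · intro f hf
    rcases (Finset.filter (fun π : Equiv.Perm α => f₀ ∘ π = f)
      (Finset.univ.filter fun π : Equiv.Perm α => col ∘ π = col)).eq_empty_or_nonempty
      with h | ⟨π₀, h⟩
    · rw [h]; simp
    · rw [Fintype.card_subtype]
      refine Finset.card_le_card_of_injOn (fun π => π₀.symm.trans π) ?_ ?_
      · intro π hπ
        simp only [Finset.coe_filter, Finset.mem_univ, true_and, Finset.mem_filter,
          Set.mem_ofPred_eq] at hπ h ⊢
        ext x
        · have h1 := congrFun hπ.1 (π₀.symm x)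
          have h2 := congrFun h.1 (π₀.symm x)
          simp_all
        · have h1 := congrFun hπ.2 (π₀.symm x)
          have h2 := congrFun h.2 (π₀.symm x)
          simp_all
      · intro π _ π' _ h
        ext x
        simpa using congrArg (fun e : Equiv.Perm α => e (π₀ x)) h

theorem exists_card_fiber_eq {α γ : Type*} [Fintype α] [Fintype γ] [DecidableEq γ]
    (a : γ → ℕ) (h : Fintype.card α = ∑ j, a j) :
    ∃ f : α → γ, ∀ j, Fintype.card {x // f x = j} = a j := by
  have e : α ≃ Σ j, Fin (a j) := Fintype.equivOfCardEq (by simpa using h)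
  refine ⟨fun x => (e x).1, fun j => ?_⟩
  rw [Fintype.card_congr ((e.subtypeEquiv fun x => Iff.rfl :
    {x // (e x).1 = j} ≃ {s : Σ j, Fin (a j) // s.1 = j}).trans (Equiv.sigmaSubtype j)),
    Fintype.card_fin]

theorem exists_card_fiber_pair_eq {α β γ : Type*} [Fintype α] [Fintype γ] [DecidableEq β]
    [DecidableEq γ] (col : α → β) (a : β → γ → ℕ)
    (h : ∀ i, Fintype.card {x // col x = i} = ∑ j, a i j) :
    ∃ f : α → γ, ∀ p : β × γ, Fintype.card {x // (col x, f x) = p} = a p.1 p.2 := by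
  choose f hf using fun i => exists_card_fiber_eq (a i) (h i)
  refine ⟨fun x => f (col x) ⟨x, rfl⟩, fun ⟨i, j⟩ => ?_⟩
  rw [← hf i j]
  refine Fintype.card_congr
    ⟨fun x => ⟨⟨x.1, congrArg Prod.fst x.2⟩, ?_⟩, fun y => ⟨y.1.1, ?_⟩, fun _ => rfl, fun _ => rfl⟩
  · obtain ⟨x, hx⟩ := x
    obtain ⟨rfl, rfl⟩ := Prod.mk.inj hx
    rfl
  · obtain ⟨⟨y, rfl⟩, rfl⟩ := y
    rfl

/-- Dividers that cut out blocks of prescribed sizes. -/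
theorem exists_dividers {n : ℕ} (N : Fin n → ℕ) :
    ∃ c : Fin (n + 1) → ℕ, Monotone c ∧ c 0 = 0 ∧ c (Fin.last n) = ∑ i, N i ∧
      ∀ i : Fin n, c i.succ = c i.castSucc + N i := by
  refine ⟨fun i => ∑ l with Fin.castSucc l < i, N l, ?_, by simp, ?_, fun i => ?_⟩
  · intro i j hij
    exact Finset.sum_le_sum_of_subset fun l hl =>
      Finset.mem_filter.2 ⟨Finset.mem_univ _, (Finset.mem_filter.1 hl).2.trans_le hij⟩
  · simp [Fin.castSucc_lt_last]
  · have : (Finset.univ.filter fun l : Fin n => l.castSucc < i.succ)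
        = insert i (Finset.univ.filter fun l : Fin n => l.castSucc < i.castSucc) := by
      ext l
      simp only [Finset.mem_filter, Finset.mem_univ, true_and, Finset.mem_insert,
        Fin.castSucc_lt_succ_iff, Fin.castSucc_lt_castSucc_iff]
      exact le_iff_eq_or_lt
    dsimp only
    rw [this, Finset.sum_insert (by simp), add_comm]

theorem card_block {n k : ℕ} {c : Fin (n + 1) → ℕ} (hc : Monotone c)
    (hl : c (Fin.last n) = k) {col : Fin k → Fin n}
    (hcol : ∀ x i, col x = i ↔ c i.castSucc ≤ (x : ℕ) ∧ (x : ℕ) < c i.succ) (i : Fin n) :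
    Fintype.card {x // col x = i} = c i.succ - c i.castSucc := by
  rw [Fintype.card_subtype, ← Nat.card_Ico, ← Finset.card_map Fin.valEmbedding]
  congr 1
  ext y
  simp only [Finset.mem_map, Finset.mem_filter, Finset.mem_univ, true_and, hcol,
    Fin.valEmbedding_apply, Finset.mem_Ico]
  constructor
  · rintro ⟨x, hx, rfl⟩
    exact hx
  · intro hy
    exact ⟨⟨y, hy.2.trans_le (hl ▸ hc (Fin.le_last _))⟩, hy, rfl⟩

/-- Supplies the bijection between positions and values within one cell, m being its entry: list
both sets in order and match them, reversing one list when `m = -1`. -/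
theorem exists_equiv_strictMono_or_strictAnti {k : ℕ} (P Q : Fin k → Prop) [DecidablePred P]
    [DecidablePred Q] (h : Fintype.card {x // P x} = Fintype.card {y // Q y}) (m : ℤ) :
    ∃ e : {x // P x} ≃ {y // Q y}, (m = 1 → StrictMono e) ∧ (m = -1 → StrictAnti e) := by
  by_cases hm : m = -1
  · let e := (monoEquivOfFin {x // P x} rfl).symm.trans
      (Fin.revOrderIso.symm.trans (monoEquivOfFin {y // Q y} h.symm).dual)
    refine ⟨e.toEquiv.trans OrderDual.ofDual, fun h1 => by omega, fun _ x y hxy => ?_⟩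
    exact e.strictMono hxy
  · let e := (monoEquivOfFin {x // P x} rfl).symm.trans (monoEquivOfFin {y // Q y} h.symm)
    exact ⟨e.toEquiv, fun _ => e.strictMono, fun h1 => absurd h1 hm⟩

/-- Rows for the positions and columns for the values that give the same number of points in
every cell come from a cellwise monotone permutation. -/
theorem exists_isCellwise {t u : ℕ} {M : Matrix (Fin t) (Fin u) ℤ} {k : ℕ}
    {col : Fin k → Fin t} {row : Fin k → Fin u} {f : Fin k → Fin u} {g : Fin k → Fin t}
    (hfg : ∀ p : Fin t × Fin u,
      Fintype.card {x // (col x, f x) = p} = Fintype.card {y // (g y, row y) = p})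
    (hf : ∀ x, M (col x) (f x) ≠ 0) :
    ∃ σ : Equiv.Perm (Fin k), IsCellwise M col row σ ∧ (∀ x, row (σ x) = f x) ∧
      ∀ y, col (σ.symm y) = g y := by
  choose e he using fun p => exists_equiv_strictMono_or_strictAnti _ _ (hfg p) (M p.1 p.2)
  let σ : Equiv.Perm (Fin k) := Equiv.ofFiberEquiv e
  have hσ : ∀ x, (g (σ x), row (σ x)) = (col x, f x) := Equiv.ofFiberEquiv_map e
  have hσe : ∀ p x (hx : (col x, f x) = p), σ x = e p ⟨x, hx⟩ := by
    rintro _ x rfl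
    rfl
  have hrow : ∀ x, row (σ x) = f x := fun x => congrArg Prod.snd (hσ x)
  refine ⟨σ, ⟨fun i j hij x hx y hy hxy => ?_, fun i j hij x hx y hy hxy => ?_, fun x => ?_⟩,
    hrow, fun y => ?_⟩
  · rw [hσe (i, j) x (Prod.ext hx.1 ((hrow x).symm.trans hx.2)),
      hσe (i, j) y (Prod.ext hy.1 ((hrow y).symm.trans hy.2))]
    exact (he (i, j)).1 hij hxy
  · rw [hσe (i, j) x (Prod.ext hx.1 ((hrow x).symm.trans hx.2)),
      hσe (i, j) y (Prod.ext hy.1 ((hrow y).symm.trans hy.2))]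
    exact (he (i, j)).2 hij hxy
  · rw [hrow]
    exact hf x
  · have := congrArg Prod.fst (hσ (σ.symm y))
    simpa using this.symm

/-- A lower bound for a grid class from the gridded permutations with `a i j` points in the
cell `(i, j)`. -/
theorem prod_factorial_le_ncard_gridClass_mul {t u : ℕ} {M : Matrix (Fin t) (Fin u) ℤ} {k : ℕ}
    (a : Fin t → Fin u → ℕ) (ha : ∑ i, ∑ j, a i j = k) (haM : ∀ i j, M i j = 0 → a i j = 0) :
    (∏ i, (∑ j, a i j).factorial) * ∏ j, (∑ i, a i j).factorial ≤
      (gridClass M k).ncard * (∏ i, ∏ j, (a i j).factorial) ^ 2 := by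
  classical
  obtain ⟨c, hc, hc0, hcl, hcN⟩ := exists_dividers fun i => ∑ j, a i j
  obtain ⟨r, hr, hr0, hrl, hrN⟩ := exists_dividers fun j => ∑ i, a i j
  rw [ha] at hcl
  rw [Finset.sum_comm, ha] at hrl
  obtain ⟨col, hcol⟩ := exists_block hc hc0 hcl
  obtain ⟨row, hrow⟩ := exists_block hr hr0 hrl
  have hcc : ∀ i, Fintype.card {x // col x = i} = ∑ j, a i j := fun i => by
    rw [card_block hc hcl hcol, hcN, Nat.add_sub_cancel_left]
  have hrc : ∀ j, Fintype.card {y // row y = j} = ∑ i, a i j := fun j => by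
    rw [card_block hr hrl hrow, hrN, Nat.add_sub_cancel_left]
  obtain ⟨f₀, hf₀⟩ := exists_card_fiber_pair_eq col a hcc
  obtain ⟨g₀, hg₀⟩ := exists_card_fiber_pair_eq row (fun j i => a i j) hrc
  have h1 := prod_factorial_le_card_mul col f₀
  have h2 := prod_factorial_le_card_mul row g₀
  simp only [hf₀, hcc] at h1
  simp only [hg₀, hrc] at h2
  set F := Finset.univ.filter fun f : Fin k → Fin u => ∀ p : Fin t × Fin u,
    Fintype.card {x // (col x, f x) = p} = a p.1 p.2 with hF
  set G := Finset.univ.filter fun g : Fin k → Fin t => ∀ p : Fin u × Fin t,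
    Fintype.card {y // (row y, g y) = p} = a p.2 p.1 with hG
  have hex : ∀ z ∈ F ×ˢ G, ∃ σ : Equiv.Perm (Fin k), IsCellwise M col row σ ∧
      (∀ x, row (σ x) = z.1 x) ∧ ∀ y, col (σ.symm y) = z.2 y := by
    rintro ⟨f, g⟩ hz
    obtain ⟨hfF, hgG⟩ := Finset.mem_product.1 hz
    replace hfF := (Finset.mem_filter.1 hfF).2
    replace hgG := (Finset.mem_filter.1 hgG).2
    refine exists_isCellwise (fun p => ?_) fun x hx => ?_
    · refine (hfF p).trans ((hgG p.swap).symm.trans ?_)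
      exact Fintype.card_congr (Equiv.subtypeEquivRight fun y => by
        simp [Prod.ext_iff, and_comm])
    · have h3 := hfF (col x, f x)
      rw [haM _ _ hx, Fintype.card_eq_zero_iff] at h3
      exact h3.false ⟨x, rfl⟩
  choose! Ψ hΨ using hex
  have hle : F.card * G.card ≤ (gridClass M k).ncard := by
    rw [← Finset.card_product, ← Set.ncard_coe_finset]
    refine Set.ncard_le_ncard_of_injOn Ψ
      (fun z hz => ⟨c, r, (hΨ z hz).1.isGridding hc hc0 hcl hr hr0 hrl hcol hrow⟩) ?_
      (Set.toFinite _)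
    intro z hz z' hz' h
    refine Prod.ext (funext fun x => ?_) (funext fun y => ?_)
    · rw [← (hΨ z hz).2.1, ← (hΨ z' hz').2.1, h]
    · rw [← (hΨ z hz).2.2, ← (hΨ z' hz').2.2, h]
  rw [Fintype.prod_prod_type] at h1
  rw [Fintype.prod_prod_type, Finset.prod_comm] at h2
  calc _ ≤ _ := Nat.mul_le_mul h1 h2
    _ = F.card * G.card * (∏ i, ∏ j, (a i j).factorial) ^ 2 := by ring
    _ ≤ _ := Nat.mul_le_mul_right _ hle

/-! ### Stirling asymptotics and the entropy bound. -/

theorem Real.mul_log_sub_self_le_log_factorial (n : ℕ) :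
    n * Real.log n - n ≤ Real.log n.factorial := by
  rcases n.eq_zero_or_pos with rfl | hn
  · simp
  · have hn' : (0 : ℝ) < n := by exact_mod_cast hn
    have h1 := Stirling.le_log_factorial_stirling hn.ne'
    have h2 : 0 ≤ Real.log n := Real.log_natCast_nonneg n
    have h3 : 0 ≤ Real.log (2 * Real.pi) := Real.log_nonneg (by linarith [Real.pi_gt_three])
    linarith

theorem Real.log_factorial_le (n : ℕ) :
    Real.log n.factorial ≤ n * Real.log n - n + (1 + Real.log n) := by
  rcases n.eq_zero_or_pos with rfl | hn
  · simp
  · induction n, hn using Nat.le_induction with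
    | base => simp
    | succ n hn ih =>
      have hn' : (0 : ℝ) < n := by exact_mod_cast hn
      have h1 := Real.one_sub_inv_le_log_of_pos (x := ((n : ℝ) + 1) / n) (by positivity)
      rw [Real.log_div (by positivity) hn'.ne', inv_div] at h1
      have h2 : ((n : ℝ) + 1) * (1 - n / (n + 1)) = 1 := by field_simp; ring
      have h3 := mul_le_mul_of_nonneg_left h1 (show (0 : ℝ) ≤ n + 1 by positivity)
      rw [h2] at h3
      rw [Nat.factorial_succ, Nat.cast_mul, Real.log_mul (by positivity) (by positivity)]
      push_cast
      linarith

/-- By Stirling, `log a!` is `a log a - a` up to `O(log k)`; subtracting `a log k` leaves a function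
of the proportion `a/k`. Continuity of `x log x` at 0 covers `w = 0`. -/
theorem tendsto_log_factorial_sub_div {a : ℕ → ℕ} {w : ℝ} (ha : ∀ k, a k ≤ k)
    (hw : Tendsto (fun k : ℕ => (a k : ℝ) / k) atTop (𝓝 w)) :
    Tendsto (fun k : ℕ => (Real.log (a k).factorial - a k * Real.log k) / k) atTop
      (𝓝 (w * Real.log w - w)) := by
  have hmain : Tendsto (fun k : ℕ => (a k : ℝ) / k * Real.log ((a k : ℝ) / k) - (a k : ℝ) / k)
      atTop (𝓝 (w * Real.log w - w)) :=
    ((Real.continuous_mul_log.tendsto w).comp hw).sub hw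
  have herr : Tendsto (fun k : ℕ => (1 + Real.log k) / (k : ℝ)) atTop (𝓝 0) := by
    have h1 := (Real.isLittleO_log_id_atTop.tendsto_div_nhds_zero).comp
      (tendsto_natCast_atTop_atTop (R := ℝ))
    have h2 := (tendsto_inv_atTop_nhds_zero_nat (𝕜 := ℝ)).add h1
    rw [add_zero] at h2
    refine h2.congr fun k => ?_
    simp only [Function.comp_apply, id]
    ring
  have hup := hmain.add herr
  rw [add_zero] at hup
  have key : ∀ k : ℕ, 0 < k → (a k : ℝ) / k * Real.log ((a k : ℝ) / k) - (a k : ℝ) / k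
      = (a k * Real.log (a k) - a k - a k * Real.log k) / k := fun k hk => by
    have hk' : (0 : ℝ) < k := by exact_mod_cast hk
    rcases (a k).eq_zero_or_pos with h | h
    · simp [h]
    · rw [Real.log_div (by exact_mod_cast h.ne') hk'.ne']
      field_simp
      ring
  refine tendsto_of_tendsto_of_tendsto_of_le_of_le' hmain hup ?_ ?_
  · filter_upwards [eventually_gt_atTop 0] with k hk
    rw [key k hk]
    have := Real.mul_log_sub_self_le_log_factorial (a k)
    gcongr
  · filter_upwards [eventually_gt_atTop 0] with k hk
    rw [key k hk, ← add_div]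
    have h1 := Real.log_factorial_le (a k)
    have h2 : Real.log (a k) ≤ Real.log k := by
      rcases (a k).eq_zero_or_pos with h | h
      · simpa [h] using Real.log_natCast_nonneg k
      · exact Real.log_le_log (by exact_mod_cast h) (by exact_mod_cast ha k)
    gcongr
    linarith

/-- Natural numbers with sum `k` in given asymptotic proportions. -/
theorem exists_tendsto_div_of_sum_eq_one {ι : Type*} [Fintype ι] {w : ι → ℝ}
    (hw : ∀ e, 0 ≤ w e) (hw1 : ∑ e, w e = 1) :
    ∃ a : ℕ → ι → ℕ, (∀ k, ∑ e, a k e = k) ∧ (∀ k e, w e = 0 → a k e = 0) ∧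
      ∀ e, Tendsto (fun k : ℕ => (a k e : ℝ) / k) atTop (𝓝 (w e)) := by
  classical
  obtain ⟨e₀, he₀⟩ : ∃ e, w e ≠ 0 := by
    by_contra! h
    simp [h] at hw1
  have hsum : ∀ k : ℕ, ∑ e, ⌊w e * k⌋₊ ≤ k := fun k => by
    have : (∑ e, (⌊w e * k⌋₊ : ℝ)) ≤ k := by
      refine (Finset.sum_le_sum fun e _ => Nat.floor_le (mul_nonneg (hw e) k.cast_nonneg)).trans ?_
      rw [← Finset.sum_mul, hw1, one_mul]
    exact_mod_cast this
  have hfl : ∀ e, Tendsto (fun k : ℕ => (⌊w e * k⌋₊ : ℝ) / k) atTop (𝓝 (w e)) := fun e =>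
    (tendsto_nat_floor_mul_div_atTop (hw e)).comp tendsto_natCast_atTop_atTop
  -- The rounding deficit goes to an index of nonzero weight, so indices of weight zero keep the
  -- count 0. The deficit is o(k) because the weights sum to 1.
  refine ⟨fun k e => ⌊w e * k⌋₊ + if e = e₀ then k - ∑ e, ⌊w e * k⌋₊ else 0,
    fun k => ?_, fun k e he => ?_, fun e => ?_⟩
  · rw [Finset.sum_add_distrib, Finset.sum_ite_eq' Finset.univ e₀, if_pos (Finset.mem_univ _)]
    exact Nat.add_sub_cancel' (hsum k)
  · have : e ≠ e₀ := fun h => he₀ (h ▸ he)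
    simp [he, this]
  · by_cases he : e = e₀
    · have h1 : Tendsto (fun k : ℕ => (⌊w e * k⌋₊ : ℝ) / k +
          ((k : ℝ) / k - ∑ e, (⌊w e * k⌋₊ : ℝ) / k)) atTop (𝓝 (w e + (1 - ∑ e, w e))) := by
        refine (hfl e).add (Tendsto.sub ?_ (tendsto_finsetSum _ fun e _ => hfl e))
        refine tendsto_const_nhds.congr' ?_
        filter_upwards [eventually_gt_atTop 0] with k hk
        rw [div_self (by exact_mod_cast hk.ne')]
      rw [hw1, sub_self, add_zero] at h1
      refine h1.congr fun k => ?_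
      dsimp only
      rw [if_pos he]
      push_cast [hsum k]
      rw [← Finset.sum_div]
      ring
    · simpa [he] using hfl e

/-- Proportions `w` of points in the cells give an exponential lower bound for a grid class. -/
theorem exists_tendsto_le_ncard_gridClass {t u : ℕ} {M : Matrix (Fin t) (Fin u) ℤ}
    {w : Fin t → Fin u → ℝ} (hw : ∀ i j, 0 ≤ w i j) (hw1 : ∑ i, ∑ j, w i j = 1)
    (hwM : ∀ i j, M i j = 0 → w i j = 0) :
    ∃ T : ℕ → ℝ, (∀ k, T k ≤ Real.log (gridClass M k).ncard / k ∧ 0 < (gridClass M k).ncard) ∧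
      Tendsto T atTop (𝓝 (∑ i, ((∑ j, w i j) * Real.log (∑ j, w i j) - ∑ j, w i j) +
        ∑ j, ((∑ i, w i j) * Real.log (∑ i, w i j) - ∑ i, w i j) -
        2 * ∑ i, ∑ j, (w i j * Real.log (w i j) - w i j))) := by
  obtain ⟨a', hsum', hzero', hlim'⟩ := exists_tendsto_div_of_sum_eq_one
    (w := fun e : Fin t × Fin u => w e.1 e.2) (fun e => hw _ _)
    (by rw [Fintype.sum_prod_type]; exact hw1)
  let a : ℕ → Fin t → Fin u → ℕ := fun k i j => a' k (i, j)
  have hsum : ∀ k, ∑ i, ∑ j, a k i j = k := fun k => by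
    rw [← Fintype.sum_prod_type (a' k)]; exact hsum' k
  have hsum2 : ∀ k, ∑ j, ∑ i, a k i j = k := fun k => by rw [Finset.sum_comm, hsum]
  have hlim : ∀ i j, Tendsto (fun k : ℕ => (a k i j : ℝ) / k) atTop (𝓝 (w i j)) :=
    fun i j => hlim' (i, j)
  have hN : ∀ k i, ∑ j, a k i j ≤ k := fun k i =>
    (Finset.single_le_sum (f := fun i => ∑ j, a k i j) (fun _ _ => Nat.zero_le _)
      (Finset.mem_univ i)).trans_eq (hsum k)
  have hR : ∀ k j, ∑ i, a k i j ≤ k := fun k j =>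
    (Finset.single_le_sum (f := fun j => ∑ i, a k i j) (fun _ _ => Nat.zero_le _)
      (Finset.mem_univ j)).trans_eq (hsum2 k)
  have ha : ∀ k i j, a k i j ≤ k := fun k i j =>
    (Finset.single_le_sum (fun _ _ => Nat.zero_le _) (Finset.mem_univ j)).trans (hN k i)
  have hlimN : ∀ i, Tendsto (fun k : ℕ => ((∑ j, a k i j : ℕ) : ℝ) / k) atTop
      (𝓝 (∑ j, w i j)) := fun i => by
    simp only [Nat.cast_sum, Finset.sum_div]
    exact tendsto_finsetSum _ fun j _ => hlim i j
  have hlimR : ∀ j, Tendsto (fun k : ℕ => ((∑ i, a k i j : ℕ) : ℝ) / k) atTop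
      (𝓝 (∑ i, w i j)) := fun j => by
    simp only [Nat.cast_sum, Finset.sum_div]
    exact tendsto_finsetSum _ fun i _ => hlim i j
  have hb : ∀ k, (∏ i, (∑ j, a k i j).factorial) * ∏ j, (∑ i, a k i j).factorial ≤
      (gridClass M k).ncard * (∏ i, ∏ j, (a k i j).factorial) ^ 2 := fun k =>
    prod_factorial_le_ncard_gridClass_mul (a k) (hsum k) fun i j hij => hzero' k (i, j) (hwM i j hij)
  have hpos : ∀ k, 0 < (gridClass M k).ncard := fun k => by
    refine Nat.pos_of_ne_zero fun h0 => ?_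
    have := hb k
    rw [h0, zero_mul] at this
    have h1 : 0 < (∏ i, (∑ j, a k i j).factorial) * ∏ j, (∑ i, a k i j).factorial :=
      Nat.mul_pos (Finset.prod_pos fun _ _ => Nat.factorial_pos _)
        (Finset.prod_pos fun _ _ => Nat.factorial_pos _)
    omega
  refine ⟨fun k => (∑ i, Real.log (∑ j, a k i j).factorial +
    ∑ j, Real.log (∑ i, a k i j).factorial -
      2 * ∑ i, ∑ j, Real.log (a k i j).factorial) / k, fun k => ⟨?_, hpos k⟩, ?_⟩
  · refine div_le_div_of_nonneg_right ?_ k.cast_nonneg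
    have h1 : ((∏ i, ((∑ j, a k i j).factorial : ℝ)) * ∏ j, ((∑ i, a k i j).factorial : ℝ)) ≤
      (gridClass M k).ncard * (∏ i, ∏ j, ((a k i j).factorial : ℝ)) ^ 2 := by
      exact_mod_cast hb k
    have hf : ∀ n : ℕ, (n.factorial : ℝ) ≠ 0 := fun n => by positivity
    have h2 := Real.log_le_log (by positivity) h1
    have hg : ((gridClass M k).ncard : ℝ) ≠ 0 := by exact_mod_cast (hpos k).ne'
    rw [Real.log_mul (by positivity) (by positivity), Real.log_mul hg (by positivity),
      Real.log_pow, Real.log_prod fun _ _ => hf _, Real.log_prod fun _ _ => hf _,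
      Real.log_prod fun _ _ => Finset.prod_ne_zero_iff.2 fun _ _ => hf _,
      Finset.sum_congr rfl fun i _ => Real.log_prod fun _ _ => hf _] at h2
    push_cast at h2
    linarith
  · have h1 := ((tendsto_finsetSum Finset.univ fun i _ =>
      tendsto_log_factorial_sub_div (hN · i) (hlimN i)).add
      (tendsto_finsetSum Finset.univ fun j _ =>
        tendsto_log_factorial_sub_div (hR · j) (hlimR j))).sub
      ((tendsto_finsetSum Finset.univ fun i _ => tendsto_finsetSum Finset.univ fun j _ =>
        tendsto_log_factorial_sub_div (ha · i j) (hlim i j)).const_mul 2)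
    refine h1.congr fun k => ?_
    simp only [← Finset.sum_div, Finset.sum_sub_distrib, ← Finset.sum_mul]
    -- Column totals, row totals and cell counts each sum to k, so the subtracted `log k` terms
    -- cancel: k + k - 2k = 0.
    have e1 : ∑ i, ((∑ j, a k i j : ℕ) : ℝ) = k := by exact_mod_cast hsum k
    have e2 : ∑ j, ((∑ i, a k i j : ℕ) : ℝ) = k := by exact_mod_cast hsum2 k
    have e3 : ∑ i, ∑ j, (a k i j : ℝ) = k := by exact_mod_cast hsum k
    rw [e1, e2, e3]
    ring

/-! ### Eigenvectors of the row-column graph. -/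

open Classical in
theorem exists_nonneg_sum_adj_eq {V : Type*} [Fintype V] [Nonempty V] (G : SimpleGraph V) :
    ∃ v : V → ℝ, v ≠ 0 ∧ (∀ i, 0 ≤ v i) ∧
      ∀ i, (∑ j, if G.Adj i j then v j else 0) = graphSpectralRadius G * v i := by
  have hA : (G.adjMatrix ℝ).IsHermitian := by
    rw [Matrix.IsHermitian, Matrix.conjTranspose_eq_transpose_of_trivial]
    exact G.isSymm_adjMatrix
  obtain ⟨v, hv0, hv, hAv⟩ := hA.exists_nonneg_eigenvector
    (fun i j => by rw [SimpleGraph.adjMatrix_apply]; split_ifs <;> simp)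
    (graphSpectralRadius_isGreatest G)
  refine ⟨v, hv0, hv, fun i => ?_⟩
  rw [← smul_eq_mul, ← Pi.smul_apply, ← hAv]
  simp [Matrix.mulVec, dotProduct, SimpleGraph.adjMatrix_apply]

open Classical in
theorem exists_pos_sum_adj_le {V : Type*} [Fintype V] [Nonempty V] (G : SimpleGraph V)
    {δ : ℝ} (hδ : 0 < δ) :
    ∃ (l : ℝ) (v : V → ℝ), 0 < l ∧ l ≤ graphSpectralRadius G + δ ∧ (∀ i, 0 < v i) ∧
      ∀ i, (∑ j, if G.Adj i j then v j else 0) ≤ l * v i := by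
  have hA : (G.adjMatrix ℝ).IsHermitian := by
    rw [Matrix.IsHermitian, Matrix.conjTranspose_eq_transpose_of_trivial]
    exact G.isSymm_adjMatrix
  obtain ⟨l, v, hl0, hl, hv, hAv⟩ := hA.exists_pos_mulVec_le
    (fun i j => by rw [SimpleGraph.adjMatrix_apply]; split_ifs <;> simp)
    (graphSpectralRadius_isGreatest G).2 hδ
  refine ⟨l, v, hl0, hl, hv, fun i => (le_of_eq ?_).trans (hAv i)⟩
  simp [Matrix.mulVec, dotProduct, SimpleGraph.adjMatrix_apply]

theorem graphSpectralRadius_nonneg {V : Type*} [Fintype V] [Nonempty V] (G : SimpleGraph V) :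
    0 ≤ graphSpectralRadius G := by
  classical
  obtain ⟨v, hv0, hv, hAv⟩ := exists_nonneg_sum_adj_eq G
  obtain ⟨i, hi⟩ := Function.ne_iff.1 hv0
  refine nonneg_of_mul_nonneg_left ?_ (lt_of_le_of_ne (hv i) (Ne.symm hi))
  rw [← hAv]
  exact Finset.sum_nonneg fun j _ => by split_ifs; exacts [hv j, le_rfl]

open Classical in
theorem sum_adj_rowColumnGraph_inr {t u : ℕ} (M : Matrix (Fin t) (Fin u) ℤ)
    (v : Fin u ⊕ Fin t → ℝ) (i : Fin t) :
    (∑ e, if (rowColumnGraph M).Adj (Sum.inr i) e then v e else 0) =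
      ∑ j, if M i j = 0 then 0 else v (Sum.inl j) := by
  have h1 (j) : (rowColumnGraph M).Adj (Sum.inr i) (Sum.inl j) ↔ M i j ≠ 0 := Iff.rfl
  have h2 (l) : ¬(rowColumnGraph M).Adj (Sum.inr i) (Sum.inr l) := id
  rw [Fintype.sum_sum_type, Finset.sum_eq_zero (fun l _ => if_neg (h2 l)), add_zero]
  refine Finset.sum_congr rfl fun j _ => ?_
  by_cases h : M i j = 0 <;> simp [h1, h]

open Classical in
theorem sum_adj_rowColumnGraph_inl {t u : ℕ} (M : Matrix (Fin t) (Fin u) ℤ)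
    (v : Fin u ⊕ Fin t → ℝ) (j : Fin u) :
    (∑ e, if (rowColumnGraph M).Adj (Sum.inl j) e then v e else 0) =
      ∑ i, if M i j = 0 then 0 else v (Sum.inr i) := by
  have h1 (i) : (rowColumnGraph M).Adj (Sum.inl j) (Sum.inr i) ↔ M i j ≠ 0 := Iff.rfl
  have h2 (l) : ¬(rowColumnGraph M).Adj (Sum.inl j) (Sum.inl l) := id
  rw [Fintype.sum_sum_type, Finset.sum_eq_zero (fun l _ => if_neg (h2 l)), zero_add]
  refine Finset.sum_congr rfl fun i _ => ?_
  by_cases h : M i j = 0 <;> simp [h1, h]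

theorem exists_nonneg_rowColumn_eq {t u : ℕ} (M : Matrix (Fin t) (Fin u) ℤ)
    [Nonempty (Fin u ⊕ Fin t)] :
    ∃ (x : Fin t → ℝ) (y : Fin u → ℝ), (∀ i, 0 ≤ x i) ∧ (∀ j, 0 ≤ y j) ∧
      0 < ∑ i, x i ^ 2 + ∑ j, y j ^ 2 ∧
      (∀ i, (∑ j, if M i j = 0 then 0 else y j) =
        graphSpectralRadius (rowColumnGraph M) * x i) ∧
      ∀ j, (∑ i, if M i j = 0 then 0 else x i) =
        graphSpectralRadius (rowColumnGraph M) * y j := by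
  classical
  obtain ⟨v, hv0, hv, hAv⟩ := exists_nonneg_sum_adj_eq (rowColumnGraph M)
  refine ⟨fun i => v (Sum.inr i), fun j => v (Sum.inl j), fun i => hv _, fun j => hv _, ?_,
    fun i => ?_, fun j => ?_⟩
  · obtain ⟨e, he⟩ := Function.ne_iff.1 hv0
    rw [add_comm, ← Fintype.sum_sum_type fun e => v e ^ 2]
    exact Finset.sum_pos' (fun e _ => sq_nonneg _) ⟨e, Finset.mem_univ _, sq_pos_of_ne_zero he⟩
  · rw [← hAv, sum_adj_rowColumnGraph_inr]
  · rw [← hAv, sum_adj_rowColumnGraph_inl]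

theorem exists_pos_rowColumn_le {t u : ℕ} (M : Matrix (Fin t) (Fin u) ℤ)
    [Nonempty (Fin u ⊕ Fin t)] {δ : ℝ} (hδ : 0 < δ) :
    ∃ (l : ℝ) (x : Fin t → ℝ) (y : Fin u → ℝ), 0 < l ∧
      l ≤ graphSpectralRadius (rowColumnGraph M) + δ ∧ (∀ i, 0 < x i) ∧ (∀ j, 0 < y j) ∧
      (∀ i, (∑ j, if M i j = 0 then 0 else y j) ≤ l * x i) ∧
      ∀ j, (∑ i, if M i j = 0 then 0 else x i) ≤ l * y j := by
  classical
  obtain ⟨l, v, hl0, hl, hv, hAv⟩ := exists_pos_sum_adj_le (rowColumnGraph M) hδ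
  refine ⟨l, fun i => v (Sum.inr i), fun j => v (Sum.inl j), hl0, hl, fun i => hv _,
    fun j => hv _, fun i => le_trans (le_of_eq ?_) (hAv _),
    fun j => le_trans (le_of_eq ?_) (hAv _)⟩
  · rw [sum_adj_rowColumnGraph_inr]
  · rw [sum_adj_rowColumnGraph_inl]

/-! ### The growth rate. -/

theorem exists_ncard_gridClass_le {t u : ℕ} {M : Matrix (Fin t) (Fin u) ℤ}
    (hM : ∀ i j, M i j = 0 ∨ M i j = 1 ∨ M i j = -1) [Nonempty (Fin u ⊕ Fin t)] {δ : ℝ}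
    (hδ : 0 < δ) :
    ∃ l : ℝ, 0 < l ∧ l ≤ graphSpectralRadius (rowColumnGraph M) + δ ∧
      ∀ k, ((gridClass M k).ncard : ℝ) ≤ ((k : ℝ) + 1) ^ (t + 1 + (u + 1)) * (l ^ 2) ^ k := by
  obtain ⟨l, x, y, hl0, hl, hx, hy, hxy, hyx⟩ := exists_pos_rowColumn_le M hδ
  refine ⟨l, hl0, hl, fun k => ?_⟩
  have h := ncard_gridClass_mul_pow_le hM k
    (p := fun i j => (if M i j = 0 then 0 else y j) / (l * x i))
    (q := fun i j => (if M i j = 0 then 0 else x i) / (l * y j)) (s := (l ^ 2)⁻¹)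
    (by positivity)
    (fun i j => div_nonneg (by split_ifs; exacts [le_rfl, (hy j).le]) (mul_pos hl0 (hx i)).le)
    (fun i j => div_nonneg (by split_ifs; exacts [le_rfl, (hx i).le]) (mul_pos hl0 (hy j)).le)
    (fun i => by
      rw [← Finset.sum_div]
      exact div_le_one_of_le₀ (hxy i) (mul_pos hl0 (hx i)).le)
    (fun j => by
      rw [← Finset.sum_div]
      exact div_le_one_of_le₀ (hyx j) (mul_pos hl0 (hy j)).le)
    (fun i j hij => by
      have := hx i
      have := hy j
      simp only [hij, if_false]
      field_simp)
  rwa [inv_pow, ← div_eq_mul_inv, div_le_iff₀ (by positivity)] at h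

theorem eventually_ncard_gridClass_rpow_lt {t u : ℕ} {M : Matrix (Fin t) (Fin u) ℤ}
    (hM : ∀ i j, M i j = 0 ∨ M i j = 1 ∨ M i j = -1) [Nonempty (Fin u ⊕ Fin t)] {b : ℝ}
    (hb : graphSpectralRadius (rowColumnGraph M) ^ 2 < b) :
    ∀ᶠ k : ℕ in atTop, ((gridClass M k).ncard : ℝ) ^ (1 / (k : ℝ)) < b := by
  set ρ := graphSpectralRadius (rowColumnGraph M) with hρ
  obtain ⟨δ, hδ, hδb⟩ : ∃ δ > 0, (ρ + δ) ^ 2 < b := by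
    have hc : Tendsto (fun δ : ℝ => (ρ + δ) ^ 2) (𝓝[>] 0) (𝓝 ((ρ + 0) ^ 2)) :=
      ((by fun_prop : Continuous fun δ : ℝ => (ρ + δ) ^ 2).tendsto 0).mono_left nhdsWithin_le_nhds
    rw [add_zero] at hc
    obtain ⟨δ, h1, h2⟩ := ((hc.eventually_lt_const hb).and self_mem_nhdsWithin).exists
    exact ⟨δ, h2, h1⟩
  obtain ⟨l, hl0, hl, hle⟩ := exists_ncard_gridClass_le hM hδ
  have hlb : l ^ 2 < b := (pow_le_pow_left₀ hl0.le hl 2).trans_lt hδb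
  have hpoly : Tendsto (fun k : ℕ => ((k : ℝ) + 1) ^ (((t + 1 + (u + 1) : ℕ) : ℝ) / k) * l ^ 2)
      atTop (𝓝 (1 * l ^ 2)) := by
    refine Tendsto.mul_const _ ?_
    -- The limit is applied at k + 1; the shift -1 turns the exponent's denominator back into k.
    have h1 := (tendsto_rpow_div_mul_add ((t + 1 + (u + 1) : ℕ) : ℝ) 1 (-1) zero_ne_one).comp
      ((tendsto_natCast_atTop_atTop (R := ℝ)).atTop_add (tendsto_const_nhds (x := (1 : ℝ))))
    refine h1.congr fun k => ?_
    simp only [Function.comp_apply]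
    congr 2
    ring
  rw [one_mul] at hpoly
  filter_upwards [hpoly.eventually_lt_const hlb, eventually_gt_atTop 0] with k hk hk0
  refine lt_of_le_of_lt ?_ hk
  have hk' : (k : ℝ) ≠ 0 := by exact_mod_cast hk0.ne'
  refine (Real.rpow_le_rpow (by positivity) (hle k) (by positivity)).trans_eq ?_
  rw [Real.mul_rpow (by positivity) (by positivity), ← Real.rpow_natCast,
    ← Real.rpow_natCast (l ^ 2) k, ← Real.rpow_mul (by positivity), ← Real.rpow_mul (by positivity),
    mul_one_div, mul_one_div, div_self hk', Real.rpow_one]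

theorem eventually_lt_ncard_gridClass_rpow {t u : ℕ} {M : Matrix (Fin t) (Fin u) ℤ}
    [Nonempty (Fin u ⊕ Fin t)] (hρ : 0 < graphSpectralRadius (rowColumnGraph M)) {b : ℝ}
    (hb : b < graphSpectralRadius (rowColumnGraph M) ^ 2) :
    ∀ᶠ k : ℕ in atTop, b < ((gridClass M k).ncard : ℝ) ^ (1 / (k : ℝ)) := by
  obtain ⟨x, y, hx, hy, hxy0, hxy, hyx⟩ := exists_nonneg_rowColumn_eq M
  set ρ := graphSpectralRadius (rowColumnGraph M)
  -- Z is the total of `x i * y j` over nonzero cells. Summing by columns or by rows shows that x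
  -- and y have equal norm, so Z is positive even though the eigenvector may have zeros.
  set Z : ℝ := ρ * ∑ i, x i ^ 2 with hZ
  have hrow : ∀ i, (∑ j, if M i j = 0 then 0 else x i * y j) = ρ * x i ^ 2 := fun i => by
    rw [sq, mul_left_comm, ← hxy, Finset.mul_sum]
    simp only [mul_ite, mul_zero]
  have hcol : ∀ j, (∑ i, if M i j = 0 then 0 else x i * y j) = ρ * y j ^ 2 := fun j => by
    rw [sq, ← mul_assoc, ← hyx, Finset.sum_mul]
    simp only [ite_mul, zero_mul]
  have hZ' : Z = ρ * ∑ j, y j ^ 2 := by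
    rw [hZ, Finset.mul_sum, Finset.mul_sum, ← Finset.sum_congr rfl fun i _ => hrow i,
      Finset.sum_comm, Finset.sum_congr rfl fun j _ => hcol j]
  have hZ0 : 0 < Z := by
    have := mul_pos hρ hxy0
    rw [mul_add, ← hZ, ← hZ'] at this
    linarith
  let w : Fin t → Fin u → ℝ := fun i j => (if M i j = 0 then 0 else x i * y j) / Z
  have hw : ∀ i j, 0 ≤ w i j := fun i j =>
    div_nonneg (by split_ifs; exacts [le_rfl, mul_nonneg (hx i) (hy j)]) hZ0.le
  have hwi : ∀ i, ∑ j, w i j = ρ * x i ^ 2 / Z := fun i => by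
    rw [← hrow, Finset.sum_div]
  have hwj : ∀ j, ∑ i, w i j = ρ * y j ^ 2 / Z := fun j => by
    rw [← hcol, Finset.sum_div]
  have hw1 : ∑ i, ∑ j, w i j = 1 := by
    simp only [hwi]
    rw [← Finset.sum_div, ← Finset.mul_sum, ← hZ, div_self hZ0.ne']
  obtain ⟨T, hT, hlim⟩ := exists_tendsto_le_ncard_gridClass (M := M) hw hw1
    fun i j hij => by simp [w, hij]
  have hval : (∑ i, ((∑ j, w i j) * Real.log (∑ j, w i j) - ∑ j, w i j) +
        ∑ j, ((∑ i, w i j) * Real.log (∑ i, w i j) - ∑ i, w i j) -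
        2 * ∑ i, ∑ j, (w i j * Real.log (w i j) - w i j)) = Real.log (ρ ^ 2) := by
    -- On a cell with `w i j ≠ 0`, (column total)(row total) = `(ρ x²/Z)(ρ y²/Z) = ρ² w²`. Thus each
    -- cell contributes its weight times `log (ρ ^ 2)`, and the weights sum to 1.
    have hterm : ∀ i j, w i j * Real.log (∑ j, w i j) + w i j * Real.log (∑ i, w i j) -
        2 * (w i j * Real.log (w i j)) = w i j * Real.log (ρ ^ 2) := fun i j => by
      rcases eq_or_ne (w i j) 0 with h | h
      · simp [h]
      · have hij : M i j ≠ 0 := fun h0 => h (by simp [w, h0])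
        have hwe : w i j = x i * y j / Z := by simp [w, hij]
        have hx0 : x i ≠ 0 := fun h0 => h (by simp [hwe, h0])
        have hy0 : y j ≠ 0 := fun h0 => h (by simp [hwe, h0])
        have hprod : (∑ j, w i j) * (∑ i, w i j) = ρ ^ 2 * w i j ^ 2 := by
          rw [hwi, hwj, hwe]; ring
        have hlog := congrArg Real.log hprod
        rw [Real.log_mul (by rw [hwi]; positivity) (by rw [hwj]; positivity),
          Real.log_mul (by positivity) (by positivity), Real.log_pow (w i j)] at hlog
        push_cast at hlog
        linear_combination w i j * hlog
    have hs := Finset.sum_congr (rfl : Finset.univ = Finset.univ) fun i _ =>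
      Finset.sum_congr (rfl : Finset.univ = Finset.univ) fun j _ => hterm i j
    simp only [Finset.sum_add_distrib, Finset.sum_sub_distrib, ← Finset.mul_sum,
      ← Finset.sum_mul] at hs
    rw [hw1, one_mul, Finset.sum_comm (f := fun i j => w i j * Real.log (∑ i, w i j))] at hs
    simp only [← Finset.sum_mul] at hs
    have hw2 : ∑ j, ∑ i, w i j = 1 := by rw [Finset.sum_comm, hw1]
    simp only [Finset.sum_sub_distrib, hw1, hw2]
    linarith
  rw [hval] at hlim
  have hexp := (Real.continuous_exp.tendsto _).comp hlim
  rw [Real.exp_log (by positivity)] at hexp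
  filter_upwards [hexp.eventually_const_lt hb] with k hk
  refine hk.trans_le ?_
  rw [Real.rpow_def_of_pos (by exact_mod_cast (hT k).2), mul_one_div]
  exact Real.exp_le_exp.2 (hT k).1

theorem mainTheorem1 {t u : ℕ} (M : Matrix (Fin t) (Fin u) ℤ)
    (hM : ∀ i j, M i j = 0 ∨ M i j = 1 ∨ M i j = -1) :
    HasGrowthRate (gridClass M) (graphSpectralRadius (rowColumnGraph M) ^ 2) := by
  unfold HasGrowthRate
  -- With no rows and no columns the spectral radius is the default `sSup ∅ = 0`, and no permutation
  -- of positive length has a gridding.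
  rcases isEmpty_or_nonempty (Fin u ⊕ Fin t) with hV | hV
  · have hρ : graphSpectralRadius (rowColumnGraph M) = 0 := by
      have : graphEigenvalues (rowColumnGraph M) = ∅ := by
        refine Set.eq_empty_of_forall_notMem fun μ hμ => ?_
        obtain ⟨v, hv⟩ := Module.End.HasEigenvalue.exists_hasEigenvector hμ
        exact hv.2 (Subsingleton.elim _ _)
      rw [graphSpectralRadius, this, Real.sSup_empty]
    obtain rfl : t = 0 := by
      by_contra h
      exact hV.false (Sum.inr ⟨0, Nat.pos_of_ne_zero h⟩)
    rw [hρ, zero_pow two_ne_zero]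
    refine tendsto_const_nhds.congr' ?_
    filter_upwards [eventually_gt_atTop 0] with k hk
    have : gridClass M k = ∅ := by
      refine Set.eq_empty_of_forall_notMem ?_
      rintro σ ⟨c, r, h⟩
      exact hk.ne (h.col_first.symm.trans h.col_last)
    rw [this, Set.ncard_empty, Nat.cast_zero, Real.zero_rpow (by positivity)]
  · refine tendsto_order.2 ⟨fun b hb => ?_, fun b hb => eventually_ncard_gridClass_rpow_lt hM hb⟩
    -- For ρ = 0 the lower bound is just nonnegativity of the terms; the entropy argument needs ρ >
    -- 0 to normalise the weights.
    rcases (graphSpectralRadius_nonneg (rowColumnGraph M)).eq_or_lt with h | h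
    · rw [← h, zero_pow two_ne_zero] at hb
      exact Eventually.of_forall fun k => hb.trans_le (by positivity)
    · exact eventually_lt_ncard_gridClass_rpow h hb
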